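/- For integers $U,V\ge 1$ and a real image $x=(x[u,v])_{0\le u<U,\,0\le v<V}$ let $$\mathscr F(x)[k,l]=\frac1{UV}\sum_{u=0}^{U-1}\sum_{v=0}^{V-1}x[u,v]\,e^{-2\pi i\left(\frac{ku}{U}+\frac{lv}{V}\right)},\qquad 0\le k<U,\ 0\le l<V,$$ and call $a(x)[k,l]=\operatorname{Re}\mathscr F(x)[k,l]$ and $b(x)[k,l]=\operatorname{Im}\mathscr F(x)[k,l]$ the (real) Fourier coefficients of $x$. Let $*$ be circular convolution, $(h*\eta)[p]=\sum_q h[q]\,\eta[p-q]$, with positions taken modulo $(U,V)$. Let $\nu$ be a probability law on $\mathbb R$ with mean $0$ and finite variance $\sigma^2$. Let $(U_N,V_N)$ be image sizes with $U_NV_N\to\infty$, let $h_N$ be any real $U_N\times V_N$ kernel, let $\eta_N$ be a $U_N\times V_N$ field of i.i.d. random variables of law $\nu$, and let $n_N=h_N*\eta_N$. For a Fourier coefficient $X$ of $n_N$ put $\tilde X=(X-\mathbb E X)/\sqrt{\operatorname{Var}X}$ if $\operatorname{Var}X\neq0$, and $\tilde X=0$ otherwise. A coefficient of $n_N$ at $[k,l]$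 has nonzero variance if and only if $\sigma^2\ne0$, $\mathscr F(h_N)[k,l]\neq 0$, and it is not the imaginary coefficient at a frequency with $[2k,2l]\equiv[0,0]$ modulo $(U_N,V_N)$; a coefficient of variance zero (a degenerate Gaussian) is $0$ almost surely. Moreover: (i) If $X_N$ is, for each $N$, any Fourier coefficient of $n_N$ (its frequency and its part may depend on $N$), and $\operatorname{Var}X_N\ne0$ for all large $N$, then $\tilde X_N$ converges in distribution to $\mathcal N(0,1)$. (ii) Different Fourier coefficients become independent: let $X_N^{(1)},\dots,X_N^{(m)}$ be Fourier coefficients of $n_N$ such that, for all large $N$, no two of them are the same part (real or imaginary) at frequencies that are equal or are mirror images $[k,l]$, $[-k,-l]$ of each other modulo $(U_N,V_N)$ (such coefficients of a real image coincide up to sign). Suppose there is a set $D\subseteq\{1,\dots,m\}$ such that for all large $N$ one has $\operatorname{Var}X_N^{(i)}\neq0$ exactly for $i\in D$. Then $(\tilde X_N^{(1)},\dots,\tilde X_N^{(m)})$ converges in distribution to the product measure $\bigotimes_{i=1}^m\mathcal N(0,\mathbf 1_{i\in D})$, where $\mathcal N(0,0)=\delta_0$. -/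

import Mathlib

open MeasureTheory ProbabilityTheory Filter
open scoped NNReal

namespace FourierNoise

/-- Real images of size `U × V`, indexed by the positions `[u, v]` with `0 ≤ u < U`, `0 ≤ v < V`. -/
abbrev Image (U V : ℕ) : Type := Fin U × Fin V → ℝ

/-- The two-dimensional discrete Fourier transform with the normalization `1 / (U V)`. -/
noncomputable def dft {U V : ℕ} (x : Image U V) (k : Fin U) (l : Fin V) : ℂ :=
  (1 / ((U : ℂ) * (V : ℂ))) * ∑ u : Fin U, ∑ v : Fin V, (x (u, v) : ℂ) *
    Complex.exp (-(Complex.I * (2 * (Real.pi : ℂ) *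
      ((k : ℂ) * (u : ℂ) / (U : ℂ) + (l : ℂ) * (v : ℂ) / (V : ℂ)))))

/-- Circular convolution `h * η` of two images; the subtraction of positions is modulo `(U, V)`. -/
def conv {U V : ℕ} (h η : Image U V) : Image U V :=
  fun p => ∑ q : Fin U × Fin V, h q * η (p - q)

/-- Which of the two real coefficients of a complex Fourier coefficient is meant. -/
inductive Part where
  | re
  | im

/-- The name of a real Fourier coefficient: a frequency `[k, l]`, and real or imaginary part. -/
structure CoeffIndex (U V : ℕ) where
  k : Fin U
  l : Fin V
  part : Part

/-- The real coefficient `a(x)[k, l]` or the imaginary coefficient `b(x)[k, l]`. -/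
noncomputable def coeff {U V : ℕ} (x : Image U V) (c : CoeffIndex U V) : ℝ :=
  match c.part with
  | Part.re => (dft x c.k c.l).re
  | Part.im => (dft x c.k c.l).im

/-- The frequency `[k, l]` is its own mirror image `[-k, -l]` modulo `(U, V)`. -/
def CoeffIndex.SelfConj {U V : ℕ} (c : CoeffIndex U V) : Prop :=
  U ∣ 2 * (c.k : ℕ) ∧ V ∣ 2 * (c.l : ℕ)

/-- Two names denote the same coefficient of a real image, up to sign: they ask for the same part,
at frequencies which are equal or mirror images `[k, l]`, `[-k, -l]` of each other
(for real `x` one has `a(x)[-k, -l] = a(x)[k, l]` and `b(x)[-k, -l] = - b(x)[k, l]`). -/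
def CoeffIndex.SameUpToConj {U V : ℕ} (c d : CoeffIndex U V) : Prop :=
  c.part = d.part ∧
    ((c.k = d.k ∧ c.l = d.l) ∨ (U ∣ (c.k : ℕ) + (d.k : ℕ) ∧ V ∣ (c.l : ℕ) + (d.l : ℕ)))

/-- The coefficient `c` of the noise `n = h * η`, as a random variable. -/
noncomputable def noiseCoeff {Ω : Type*} {U V : ℕ} (h : Image U V)
    (η : Fin U × Fin V → Ω → ℝ) (c : CoeffIndex U V) (ω : Ω) : ℝ :=
  coeff (conv h (fun p => η p ω)) c

/-- The normalized random variable `(X - μ[X]) / σ[X]`; it is `0` if `σ[X] = 0`. -/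
noncomputable def standardize {Ω : Type*} [MeasurableSpace Ω] (P : Measure Ω) (X : Ω → ℝ)
    (ω : Ω) : ℝ :=
  (X ω - ∫ ω', X ω' ∂P) / Real.sqrt (variance X P)

end FourierNoise

/-! ### A central limit theorem for weighted sums of i.i.d. variables. -/

namespace FourierNoise

/-! By the convolution theorem (`dft_conv`) every coefficient of `h * η` is a weighted sum of the
i.i.d. noise, whose weights are real or imaginary parts of one complex number, `dft h` at the
frequency, times a character.

Two facts about these weights suffice. Orthogonality of characters makes the weight vectors of
different coefficients exactly orthogonal (`sum_weight_mul_weight_eq_zero`). Characters have modulus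
one, so no weight exceeds `‖dft h‖`, while the energy of a nonzero weight vector is at least `U V
‖dft h‖² / 2`; hence each normalized weight is `O((U V)^(-1/2))`, whatever the kernel and frequency
(`weight_sq_le`, `abs_weight_div_sqrt_variance_le`).

Uniformly small orthonormal weights give a Gaussian limit (`tendstoInDistribution_weighted_sum`).
The characteristic function of the vector is a product of values of `charFun ν` at small arguments.
Replacing each factor by that of a Gaussian of the same variance costs `o` of the squared argument,
and the squares have fixed sum. Orthonormality turns the Gaussian product into that of independent
coordinates, and Lévy's continuity theorem concludes. Part (i) is the case `m = 1`. -/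

/-- Telescoping: factors are exchanged one at a time, the others having norm at most one. -/
lemma norm_prod_sub_prod_le {ι : Type*} (s : Finset ι) (z w : ι → ℂ)
    (hz : ∀ i, ‖z i‖ ≤ 1) (hw : ∀ i, ‖w i‖ ≤ 1) :
    ‖∏ i ∈ s, z i - ∏ i ∈ s, w i‖ ≤ ∑ i ∈ s, ‖z i - w i‖ := by
  classical
  induction s using Finset.induction_on with
  | empty => simp
  | insert a s ha ih =>
    rw [Finset.prod_insert ha, Finset.prod_insert ha, Finset.sum_insert ha]
    have hp : ‖∏ i ∈ s, w i‖ ≤ 1 := by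
      rw [norm_prod]
      exact Finset.prod_le_one (fun _ _ => norm_nonneg _) fun i _ => hw i
    calc ‖z a * ∏ i ∈ s, z i - w a * ∏ i ∈ s, w i‖
        = ‖(z a - w a) * ∏ i ∈ s, w i + z a * (∏ i ∈ s, z i - ∏ i ∈ s, w i)‖ := by
          congr 1; ring
      _ ≤ ‖z a - w a‖ * ‖∏ i ∈ s, w i‖ + ‖z a‖ * ‖∏ i ∈ s, z i - ∏ i ∈ s, w i‖ := by
          rw [← norm_mul, ← norm_mul]; exact norm_add_le _ _
      _ ≤ ‖z a - w a‖ * 1 + 1 * ∑ i ∈ s, ‖z i - w i‖ := by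
          gcongr
          exact hz a
      _ = _ := by ring

/-- A centred square-integrable law and the Gaussian law of the same variance have
characteristic functions that agree to second order at `0`. -/
lemma charFun_sub_charFun_gaussianReal_isLittleO (ν : Measure ℝ) [IsProbabilityMeasure ν]
    (hν2 : MemLp id 2 ν) (hν0 : ∫ x, x ∂ν = 0) :
    (fun t : ℝ => charFun ν t - charFun (gaussianReal 0 (variance id ν).toNNReal) t)
      =o[nhds 0] fun t => t ^ 2 := by
  set γ := gaussianReal 0 (variance id ν).toNNReal
  have hγ2 : MemLp id 2 γ := memLp_id_gaussianReal' 2 (by simp)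
  have hγ0 : ∫ x, x ∂γ = 0 := integral_id_gaussianReal
  have hsq : ∫ x, x ^ 2 ∂ν = ∫ x, x ^ 2 ∂γ := by
    have h1 := variance_of_integral_eq_zero (μ := ν) (X := id) aemeasurable_id hν0
    have h2 := variance_of_integral_eq_zero (μ := γ) (X := id) aemeasurable_id hγ0
    rw [variance_id_gaussianReal, Real.coe_toNNReal _ (variance_nonneg _ _)] at h2
    simpa using h1.symm.trans h2
  -- The quadratic Taylor polynomial depends only on the mass and the first two moments, which
  -- agree.
  have hT : ∀ t, taylorWithinEval (charFun ν) 2 Set.univ 0 t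
      = taylorWithinEval (charFun γ) 2 Set.univ 0 t := by
    intro t
    rw [taylorWithinEval_charFun_zero (n := 2) (by exact_mod_cast hν2),
      taylorWithinEval_charFun_zero (n := 2) (by exact_mod_cast hγ2)]
    simp [Finset.sum_range_succ, hν0, hγ0, hsq]
  have h1 := taylor_isLittleO_univ (x₀ := 0)
    (contDiff_charFun (μ := ν) (n := 2) (by exact_mod_cast hν2))
  have h2 := taylor_isLittleO_univ (x₀ := 0)
    (contDiff_charFun (μ := γ) (n := 2) (by exact_mod_cast hγ2))
  refine (h1.sub h2).congr (fun t => ?_) fun t => by simp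
  rw [hT]; ring

/-- The factor `variance id ν` lets the errors add up to the normalized energy of the weights. For
zero variance the bound demands equality, which holds since both laws are then `δ₀`. -/
lemma exists_norm_charFun_sub_charFun_gaussianReal_le (ν : Measure ℝ) [IsProbabilityMeasure ν]
    (hν2 : MemLp id 2 ν) (hν0 : ∫ x, x ∂ν = 0) {ε : ℝ} (hε : 0 < ε) :
    ∃ δ > 0, ∀ t : ℝ, |t| < δ →
      ‖charFun ν t - charFun (gaussianReal 0 (variance id ν).toNNReal) t‖
        ≤ ε * (variance id ν * t ^ 2) := by
  rcases (variance_nonneg id ν).eq_or_lt with h0 | hpos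
  · refine ⟨1, one_pos, fun t _ => ?_⟩
    have hae : ∀ᵐ x ∂ν, x = 0 := by
      simpa [hν0] using ae_eq_integral_of_variance_eq_zero hν2 h0.symm
    have : charFun ν t = 1 := by
      rw [charFun_apply_real]
      trans ∫ _, (1 : ℂ) ∂ν
      · refine integral_congr_ae ?_
        filter_upwards [hae] with x hx
        simp [hx]
      · simp
    simp [this, ← h0]
  · have h := (charFun_sub_charFun_gaussianReal_isLittleO ν hν2 hν0).def (mul_pos hε hpos)
    obtain ⟨δ, hδ, h⟩ := Metric.eventually_nhds_iff.1 h
    refine ⟨δ, hδ, fun t ht => ?_⟩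
    have := h (y := t) (by simpa using ht)
    simpa [mul_assoc] using this

/-- Lindeberg replacement: the limit is itself a product of Gaussian characteristic functions at the
same arguments `a N p`, so the two products are compared factor by factor. -/
lemma tendsto_prod_charFun {ι : ℕ → Type*} [∀ N, Fintype (ι N)] (ν : Measure ℝ)
    [IsProbabilityMeasure ν] (hν2 : MemLp id 2 ν) (hν0 : ∫ x, x ∂ν = 0) (a : ∀ N, ι N → ℝ)
    {s : ℝ} (hs : ∀ᶠ N in atTop, variance id ν * ∑ p, a N p ^ 2 = s)
    {ε : ℕ → ℝ} (hε : Tendsto ε atTop (nhds 0)) (ha : ∀ᶠ N in atTop, ∀ p, |a N p| ≤ ε N) :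
    Tendsto (fun N => ∏ p, charFun ν (a N p)) atTop (nhds (Complex.exp (-s / 2))) := by
  rw [Metric.tendsto_nhds]
  intro e he
  have hs0 : 0 ≤ s := by
    obtain ⟨N, hN⟩ := hs.exists
    rw [← hN]
    exact mul_nonneg (variance_nonneg _ _) (Finset.sum_nonneg fun _ _ => sq_nonneg _)
  -- With this tolerance the total error is `e * (s / (s + 1)) < e`, also when `s = 0`.
  obtain ⟨δ, hδ, hb⟩ := exists_norm_charFun_sub_charFun_gaussianReal_le ν hν2 hν0
    (ε := e / (s + 1)) (by positivity)
  filter_upwards [hs, ha, hε.eventually_lt_const hδ] with N hN haN hεN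
  have hexp : Complex.exp (-s / 2)
      = ∏ p, charFun (gaussianReal 0 (variance id ν).toNNReal) (a N p) := by
    simp only [charFun_gaussianReal]
    rw [← Complex.exp_sum, ← hN]
    congr 1
    simp only [Real.coe_toNNReal _ (variance_nonneg _ _)]
    push_cast
    rw [Finset.mul_sum, ← Finset.sum_neg_distrib, Finset.sum_div]
    exact Finset.sum_congr rfl fun p _ => by ring
  rw [hexp, dist_eq_norm]
  calc _ ≤ ∑ p, ‖charFun ν (a N p)
            - charFun (gaussianReal 0 (variance id ν).toNNReal) (a N p)‖ :=
        norm_prod_sub_prod_le _ _ _ (fun _ => norm_charFun_le_one _)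
          fun _ => norm_charFun_le_one _
    _ ≤ ∑ p, e / (s + 1) * (variance id ν * a N p ^ 2) :=
        Finset.sum_le_sum fun p _ => hb _ ((haN p).trans_lt hεN)
    _ = e * (s / (s + 1)) := by
        rw [← Finset.mul_sum, ← Finset.mul_sum, hN]; ring
    _ < e * 1 := by
        gcongr
        rw [div_lt_one (by positivity)]; linarith
    _ = e := mul_one e

/-- Pairing the vector with `t` gives a single weighted sum of the noise, and independence
factorizes its characteristic function. -/
lemma charFun_map_weighted_sum {ι Ω : Type*} [Fintype ι] [MeasurableSpace Ω] {P : Measure Ω}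
    [IsProbabilityMeasure P] {ν : Measure ℝ} {η : ι → Ω → ℝ}
    (hlaw : ∀ p, HasLaw (η p) ν P) (hindep : iIndepFun η P) {m : ℕ} (b : Fin m → ι → ℝ)
    (t : EuclideanSpace ℝ (Fin m)) :
    charFun (P.map fun ω => WithLp.toLp 2 fun i => ∑ p, b i p * η p ω) t
      = ∏ p, charFun ν (∑ i, t i * b i p) := by
  have hm : ∀ p, AEMeasurable (η p) P := fun p => (hlaw p).aemeasurable
  set a : ι → ℝ := fun p => ∑ i, t i * b i p with ha
  have key : charFun (P.map fun ω => ∑ p, a p * η p ω) 1 = ∏ p, charFun ν (a p) := by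
    rw [iIndepFun.charFun_map_fun_sum_eq_prod (X := fun p ω => a p * η p ω)
      (fun p => (hm p).const_mul _)
      (hindep.comp (fun p x => a p * x) fun p => by fun_prop), Finset.prod_apply]
    refine Finset.prod_congr rfl fun p _ => ?_
    rw [charFun_map_mul_comp (hm p), (hlaw p).map_eq, mul_one]
  rw [← key, charFun_apply, charFun_apply_real, integral_map, integral_map]
  · refine integral_congr_ae (ae_of_all _ fun ω => ?_)
    simp only [PiLp.inner_apply, ha]
    congr 2
    simp only [Complex.ofReal_one, one_mul]
    congr 1
    simp only [Finset.sum_mul, RCLike.inner_apply, conj_trivial, Finset.mul_sum]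
    rw [Finset.sum_comm]
    exact Finset.sum_congr rfl fun p _ => Finset.sum_congr rfl fun i _ => by ring
  · exact Finset.aemeasurable_fun_sum _ fun p _ => (hm p).const_mul _
  · fun_prop
  · refine (PiLp.continuous_toLp 2 _).measurable.comp_aemeasurable (aemeasurable_pi_lambda _ fun i => ?_)
    exact Finset.aemeasurable_fun_sum _ fun p _ => (hm p).const_mul _
  · fun_prop

/-- Central limit theorem for triangular arrays of weighted sums of i.i.d. variables: if the
weight vectors are orthonormal for the covariance of the noise (those outside `D` being zero), and
the weights are uniformly small, the vector of sums is asymptotically standard Gaussian. -/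
theorem tendstoInDistribution_weighted_sum {ι : ℕ → Type*} [∀ N, Fintype (ι N)] (ν : Measure ℝ)
    [IsProbabilityMeasure ν] (hν2 : MemLp id 2 ν) (hν0 : ∫ x, x ∂ν = 0)
    {Ω : ℕ → Type*} [∀ N, MeasurableSpace (Ω N)]
    (P : ∀ N, Measure (Ω N)) [∀ N, IsProbabilityMeasure (P N)]
    (η : ∀ N, ι N → Ω N → ℝ) (hlaw : ∀ N p, HasLaw (η N p) ν (P N))
    (hindep : ∀ N, iIndepFun (η N) (P N)) {m : ℕ} (b : ∀ N, Fin m → ι N → ℝ)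
    (D : Finset (Fin m))
    (horth : ∀ᶠ N in atTop, ∀ i j,
      variance id ν * ∑ p, b N i p * b N j p = if i = j ∧ i ∈ D then 1 else 0)
    {ε : ℕ → ℝ} (hε : Tendsto ε atTop (nhds 0))
    (hb : ∀ᶠ N in atTop, ∀ i p, |b N i p| ≤ ε N) :
    TendstoInDistribution (fun N ω i => ∑ p, b N i p * η N p ω)
      atTop (id : (Fin m → ℝ) → (Fin m → ℝ)) P
      (Measure.pi (fun i => gaussianReal 0 (if i ∈ D then (1 : ℝ≥0) else 0))) := by
  have hmeas : ∀ N, AEMeasurable (fun ω => WithLp.toLp 2 fun i => ∑ p, b N i p * η N p ω)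
      (P N) := fun N => by
    refine (PiLp.continuous_toLp 2 _).measurable.comp_aemeasurable
      (aemeasurable_pi_lambda _ fun i => ?_)
    exact Finset.aemeasurable_fun_sum _ fun p _ => (hlaw N p).aemeasurable.const_mul _
  have hlim : AEMeasurable (WithLp.toLp 2 : (Fin m → ℝ) → EuclideanSpace ℝ (Fin m))
      (Measure.pi (fun i => gaussianReal 0 (if i ∈ D then (1 : ℝ≥0) else 0))) :=
    (PiLp.continuous_toLp 2 _).measurable.aemeasurable
  -- `charFun` uses an inner product, so convergence is proved in `EuclideanSpace` and carried back
  -- by a continuous map.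
  have main : TendstoInDistribution
      (fun N ω => (WithLp.toLp 2 fun i => ∑ p, b N i p * η N p ω : EuclideanSpace ℝ (Fin m)))
      atTop (WithLp.toLp 2 : (Fin m → ℝ) → EuclideanSpace ℝ (Fin m)) P
      (Measure.pi (fun i => gaussianReal 0 (if i ∈ D then (1 : ℝ≥0) else 0))) := by
    refine ⟨hmeas, hlim, ProbabilityMeasure.tendsto_iff_tendsto_charFun.2 fun t => ?_⟩
    simp only [ProbabilityMeasure.coe_mk]
    rw [charFun_pi]
    simp only [charFun_map_weighted_sum (hlaw _) (hindep _)]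
    have hR : ∏ i, charFun (gaussianReal 0 (if i ∈ D then (1 : ℝ≥0) else 0)) (t i)
        = Complex.exp (-((∑ i, if i ∈ D then t i ^ 2 else 0 : ℝ) : ℂ) / 2) := by
      simp only [charFun_gaussianReal]
      rw [← Complex.exp_sum]
      congr 1
      push_cast
      rw [← Finset.sum_neg_distrib, Finset.sum_div]
      refine Finset.sum_congr rfl fun i _ => ?_
      split_ifs <;> simp [neg_div]
    rw [hR]
    refine tendsto_prod_charFun ν hν2 hν0 _ ?_ (ε := fun N => (∑ i, |t i|) * ε N) ?_ ?_
    -- The energy of the combined weights is the quadratic form at `t` of their Gram matrix, which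
    -- `horth` makes the diagonal projection onto `D`.
    · filter_upwards [horth] with N hN
      have : ∀ p, (∑ i, t i * b N i p) ^ 2
          = ∑ i, ∑ j, t i * t j * (b N i p * b N j p) := fun p => by
        rw [sq, Finset.sum_mul_sum]
        exact Finset.sum_congr rfl fun i _ => Finset.sum_congr rfl fun j _ => by ring
      simp only [this]
      rw [Finset.sum_comm, Finset.mul_sum]
      refine Finset.sum_congr rfl fun i _ => ?_
      rw [Finset.sum_comm, Finset.mul_sum]
      trans ∑ j, t i * t j * (if i = j ∧ i ∈ D then 1 else 0)
      · refine Finset.sum_congr rfl fun j _ => ?_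
        rw [← hN i j, ← Finset.mul_sum]; ring
      · rw [Finset.sum_eq_single i]
        · simp [sq]
        · intro j _ hj; simp [Ne.symm hj]
        · simp
    · simpa using hε.const_mul (∑ i, |t i|)
    · filter_upwards [hb] with N hN p
      rw [Finset.sum_mul]
      refine (Finset.abs_sum_le_sum_abs _ _).trans (Finset.sum_le_sum fun i _ => ?_)
      rw [abs_mul]
      exact mul_le_mul_of_nonneg_left (hN i p) (abs_nonneg _)
  exact main.continuous_comp (PiLp.continuous_ofLp 2 _)

end FourierNoise

/-! ### Characters, the convolution theorem and the Gram matrix of the weights. -/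

namespace FourierNoise

open scoped ComplexConjugate

/-- The character of frequency `[a, b]` on positions modulo `(U, V)`. -/
noncomputable def fourierExp {U V : ℕ} (a b : ℤ) (p : Fin U × Fin V) : ℂ :=
  Complex.exp (-(Complex.I * (2 * (Real.pi : ℂ) *
      ((a : ℂ) * (p.1 : ℂ) / (U : ℂ) + (b : ℂ) * (p.2 : ℂ) / (V : ℂ)))))

lemma fourierExp_mul {U V : ℕ} (a b a' b' : ℤ) (p : Fin U × Fin V) :
    fourierExp a b p * fourierExp a' b' p = fourierExp (a + a') (b + b') p := by
  simp only [fourierExp, ← Complex.exp_add]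
  congr 1; push_cast; ring

lemma conj_fourierExp {U V : ℕ} (a b : ℤ) (p : Fin U × Fin V) :
    conj (fourierExp a b p) = fourierExp (-a) (-b) p := by
  simp only [fourierExp, ← Complex.exp_conj]
  congr 1
  simp only [map_neg, map_mul, map_add, map_div₀, Complex.conj_I, Complex.conj_ofReal,
    map_natCast, map_intCast, map_ofNat]
  push_cast; ring

lemma norm_fourierExp {U V : ℕ} (a b : ℤ) (p : Fin U × Fin V) : ‖fourierExp a b p‖ = 1 := by
  have : fourierExp a b p = Complex.exp (((-(2 * Real.pi *
      (a * (p.1 : ℕ) / U + b * (p.2 : ℕ) / V)) : ℝ) : ℂ) * Complex.I) := by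
    simp only [fourierExp]; congr 1; push_cast; ring
  rw [this, Complex.norm_exp_ofReal_mul_I]

lemma exp_neg_two_pi_I_int_mul (n : ℤ) : Complex.exp (-(2 * Real.pi * Complex.I * n)) = 1 := by
  rw [Complex.exp_eq_one_iff]
  exact ⟨-n, by push_cast; ring⟩

lemma fourierExp_eq_one {U V : ℕ} {a b : ℤ} (hU : 0 < U) (hV : 0 < V) (ha : (U : ℤ) ∣ a)
    (hb : (V : ℤ) ∣ b) (p : Fin U × Fin V) : fourierExp a b p = 1 := by
  obtain ⟨x, rfl⟩ := ha
  obtain ⟨y, rfl⟩ := hb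
  have hU' : (U : ℂ) ≠ 0 := by exact_mod_cast hU.ne'
  have hV' : (V : ℂ) ≠ 0 := by exact_mod_cast hV.ne'
  rw [← exp_neg_two_pi_I_int_mul (x * (p.1 : ℕ) + y * (p.2 : ℕ)), fourierExp]
  congr 1; push_cast; field_simp

/-- Addition in `Fin` wraps around; the carry shifts the phase by an integer multiple of `2π`
because the frequencies are integers. -/
lemma fourierExp_add {U V : ℕ} [NeZero U] [NeZero V] (a b : ℤ) (p q : Fin U × Fin V) :
    fourierExp a b (p + q) = fourierExp a b p * fourierExp a b q := by
  have hU : (U : ℂ) ≠ 0 := by exact_mod_cast NeZero.ne U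
  have hV : (V : ℂ) ≠ 0 := by exact_mod_cast NeZero.ne V
  have hval : ∀ {n : ℕ} (x y : Fin n), ∃ j : ℤ,
      (((x + y : Fin n) : ℕ) : ℂ) = (x : ℕ) + (y : ℕ) - n * j := fun {n} x y => by
    refine ⟨(((x : ℕ) + (y : ℕ)) / n : ℕ), ?_⟩
    have := Nat.mod_add_div ((x : ℕ) + (y : ℕ)) n
    rw [Fin.val_add, eq_sub_iff_add_eq, Int.cast_natCast]
    exact_mod_cast congrArg (Nat.cast : ℕ → ℂ) this
  obtain ⟨i, hi⟩ := hval p.1 q.1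
  obtain ⟨j, hj⟩ := hval p.2 q.2
  rw [← mul_one (fourierExp a b p * fourierExp a b q),
    ← exp_neg_two_pi_I_int_mul (-(a * i + b * j))]
  simp only [fourierExp, ← Complex.exp_add, Prod.fst_add, Prod.snd_add, hi, hj]
  congr 1; push_cast; field_simp; ring

/-- A geometric sum whose ratio is a `U`-th root of unity other than one. -/
lemma sum_exp_eq_zero {U : ℕ} (hU : 0 < U) {a : ℤ} (ha : ¬ (U : ℤ) ∣ a) :
    ∑ u : Fin U, Complex.exp (-(Complex.I * (2 * (Real.pi : ℂ) *
      ((a : ℂ) * (u : ℂ) / (U : ℂ))))) = 0 := by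
  have hU' : (U : ℂ) ≠ 0 := by exact_mod_cast hU.ne'
  set r : ℂ := Complex.exp (-(Complex.I * (2 * (Real.pi : ℂ) * ((a : ℂ) / (U : ℂ))))) with hr
  have hpow : ∀ u : ℕ, Complex.exp (-(Complex.I * (2 * (Real.pi : ℂ) *
      ((a : ℂ) * (u : ℂ) / (U : ℂ))))) = r ^ u := fun u => by
    rw [hr, ← Complex.exp_nat_mul]; congr 1; ring
  have hr1 : r ≠ 1 := by
    rw [hr, Ne, Complex.exp_eq_one_iff]
    rintro ⟨n, hn⟩
    refine ha ⟨-n, ?_⟩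
    have hpi : (2 * (Real.pi : ℂ) * Complex.I) ≠ 0 := Complex.two_pi_I_ne_zero
    have : -((a : ℂ) / U) = n := by
      apply mul_right_cancel₀ hpi
      rw [← hn]; ring
    have h2 : (a : ℂ) = U * (-n) := by
      rw [← this]; field_simp
    exact_mod_cast h2
  simp only [hpow]
  rw [Fin.sum_univ_eq_sum_range (fun u => r ^ u) U, geom_sum_eq hr1]
  have : r ^ U = 1 := by
    rw [← hpow U, ← exp_neg_two_pi_I_int_mul a]
    congr 1; field_simp
  simp [this]

open Classical in
lemma sum_fourierExp {U V : ℕ} (hU : 0 < U) (hV : 0 < V) (a b : ℤ) :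
    ∑ p : Fin U × Fin V, fourierExp a b p
      = if (U : ℤ) ∣ a ∧ (V : ℤ) ∣ b then ((U * V : ℕ) : ℂ) else 0 := by
  split_ifs with h
  · simp [fourierExp_eq_one hU hV h.1 h.2]
  · have hsplit : ∑ p : Fin U × Fin V, fourierExp a b p
        = (∑ u : Fin U, Complex.exp (-(Complex.I * (2 * (Real.pi : ℂ) *
            ((a : ℂ) * (u : ℂ) / (U : ℂ)))))) *
          ∑ v : Fin V, Complex.exp (-(Complex.I * (2 * (Real.pi : ℂ) *
            ((b : ℂ) * (v : ℂ) / (V : ℂ))))) := by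
      rw [Fintype.sum_mul_sum, Fintype.sum_prod_type]
      refine Finset.sum_congr rfl fun u _ => Finset.sum_congr rfl fun v _ => ?_
      simp only [fourierExp, ← Complex.exp_add]
      congr 1; ring
    rw [hsplit]
    by_cases ha : (U : ℤ) ∣ a
    · rw [sum_exp_eq_zero hV fun hb => h ⟨ha, hb⟩, mul_zero]
    · rw [sum_exp_eq_zero hU ha, zero_mul]

lemma dft_eq_sum_fourierExp {U V : ℕ} (x : Image U V) (k : Fin U) (l : Fin V) :
    dft x k l = (1 / ((U : ℂ) * (V : ℂ))) * ∑ p, (x p : ℂ) * fourierExp (k : ℕ) (l : ℕ) p := by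
  rw [Fintype.sum_prod_type]
  simp [dft, fourierExp]

/-- The convolution theorem. -/
lemma dft_conv {U V : ℕ} (hU : 0 < U) (hV : 0 < V) (h x : Image U V) (k : Fin U) (l : Fin V) :
    dft (conv h x) k l = dft h k l * ∑ p, (x p : ℂ) * fourierExp (k : ℕ) (l : ℕ) p := by
  have : NeZero U := ⟨hU.ne'⟩
  have : NeZero V := ⟨hV.ne'⟩
  rw [dft_eq_sum_fourierExp, dft_eq_sum_fourierExp, mul_assoc]
  congr 1
  simp only [conv]
  push_cast
  simp only [Finset.sum_mul]
  rw [Finset.sum_comm]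
  refine Finset.sum_congr rfl fun q _ => ?_
  -- Translating the position by `q` frees the argument of `x`, and the character splits.
  rw [← Equiv.sum_comp (Equiv.addRight q), Finset.mul_sum]
  refine Finset.sum_congr rfl fun p _ => ?_
  simp only [Equiv.coe_addRight, add_sub_cancel_right, fourierExp_add]
  ring

/-- The real or imaginary part of a complex number. -/
def Part.proj : Part → ℂ → ℝ
  | Part.re, z => z.re
  | Part.im, z => z.im

lemma coeff_eq_proj {U V : ℕ} (x : Image U V) (c : CoeffIndex U V) :
    coeff x c = c.part.proj (dft x c.k c.l) := by
  rcases c with ⟨k, l, _ | _⟩ <;> rfl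

/-- The weight of the noise at the position `p` in a coefficient of `h * η`. -/
noncomputable def weight {U V : ℕ} (h : Image U V) (c : CoeffIndex U V) (p : Fin U × Fin V) : ℝ :=
  c.part.proj (dft h c.k c.l * fourierExp (c.k : ℕ) (c.l : ℕ) p)

lemma noiseCoeff_eq_sum_weight {Ω : Type*} {U V : ℕ} (hU : 0 < U) (hV : 0 < V) (h : Image U V)
    (η : Fin U × Fin V → Ω → ℝ) (c : CoeffIndex U V) (ω : Ω) :
    noiseCoeff h η c ω = ∑ p, weight h c p * η p ω := by
  rw [noiseCoeff, coeff_eq_proj, dft_conv hU hV, Finset.mul_sum]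
  rcases c with ⟨k, l, _ | _⟩
  · simp only [Part.proj, weight, Complex.re_sum]
    refine Finset.sum_congr rfl fun p _ => ?_
    rw [mul_left_comm, Complex.re_ofReal_mul, mul_comm]
  · simp only [Part.proj, weight, Complex.im_sum]
    refine Finset.sum_congr rfl fun p _ => ?_
    rw [mul_left_comm, Complex.im_ofReal_mul, mul_comm]

/-- The Fourier transform of a real image takes conjugate values at mirror frequencies. -/
lemma dft_eq_conj_of_mirror {U V : ℕ} (hU : 0 < U) (hV : 0 < V) (x : Image U V)
    {k k' : Fin U} {l l' : Fin V} (hk : U ∣ (k : ℕ) + (k' : ℕ)) (hl : V ∣ (l : ℕ) + (l' : ℕ)) :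
    dft x k' l' = conj (dft x k l) := by
  simp only [dft_eq_sum_fourierExp, map_mul, map_sum, map_div₀, map_one, map_natCast,
    Complex.conj_ofReal, conj_fourierExp]
  congr 1
  refine Finset.sum_congr rfl fun p _ => ?_
  congr 1
  have h1 : fourierExp (((k : ℕ) : ℤ) + (k' : ℕ)) (((l : ℕ) : ℤ) + (l' : ℕ)) p = 1 :=
    fourierExp_eq_one hU hV (by exact_mod_cast hk) (by exact_mod_cast hl) p
  rw [← one_mul (fourierExp (-((k : ℕ) : ℤ)) (-((l : ℕ) : ℤ)) p), ← h1, fourierExp_mul]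
  congr 1 <;> ring

lemma natCast_dvd_sub_iff {U : ℕ} (k k' : Fin U) :
    (U : ℤ) ∣ ((k : ℕ) : ℤ) + -((k' : ℕ) : ℤ) ↔ k = k' := by
  constructor
  · intro h
    have hk := k.2
    have hk' := k'.2
    have := Int.eq_zero_of_abs_lt_dvd h (by rw [abs_lt]; omega)
    ext; omega
  · rintro rfl; simp

-- Only mirror frequencies contribute, and there the two values of `dft h` are conjugate. Writing
-- the result as a cast real makes its imaginary part visibly zero.
open Classical in
lemma sum_mul_fourierExp {U V : ℕ} (hU : 0 < U) (hV : 0 < V) (h : Image U V)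
    (c d : CoeffIndex U V) :
    ∑ p : Fin U × Fin V, (dft h c.k c.l * fourierExp (c.k : ℕ) (c.l : ℕ) p) *
        (dft h d.k d.l * fourierExp (d.k : ℕ) (d.l : ℕ) p)
      = (((if U ∣ (c.k : ℕ) + (d.k : ℕ) ∧ V ∣ (c.l : ℕ) + (d.l : ℕ) then
          ((U * V : ℕ) : ℝ) * ‖dft h c.k c.l‖ ^ 2 else 0 : ℝ)) : ℂ) := by
  have : ∀ p : Fin U × Fin V, (dft h c.k c.l * fourierExp (c.k : ℕ) (c.l : ℕ) p) *
        (dft h d.k d.l * fourierExp (d.k : ℕ) (d.l : ℕ) p)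
      = dft h c.k c.l * dft h d.k d.l *
        fourierExp (((c.k : ℕ) : ℤ) + (d.k : ℕ)) (((c.l : ℕ) : ℤ) + (d.l : ℕ)) p := fun p => by
    rw [← fourierExp_mul]; ring
  simp only [this]
  rw [← Finset.mul_sum, sum_fourierExp hU hV]
  have hiff : ((U : ℤ) ∣ ((c.k : ℕ) : ℤ) + (d.k : ℕ) ∧ (V : ℤ) ∣ ((c.l : ℕ) : ℤ) + (d.l : ℕ))
      ↔ (U ∣ (c.k : ℕ) + (d.k : ℕ) ∧ V ∣ (c.l : ℕ) + (d.l : ℕ)) := by norm_cast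
  simp only [hiff]
  split_ifs with hcd
  · rw [dft_eq_conj_of_mirror hU hV h hcd.1 hcd.2, Complex.mul_conj, Complex.normSq_eq_norm_sq]
    push_cast; ring
  · simp

open Classical in
lemma sum_mul_conj_fourierExp {U V : ℕ} (hU : 0 < U) (hV : 0 < V) (h : Image U V)
    (c d : CoeffIndex U V) :
    ∑ p : Fin U × Fin V, (dft h c.k c.l * fourierExp (c.k : ℕ) (c.l : ℕ) p) *
        conj (dft h d.k d.l * fourierExp (d.k : ℕ) (d.l : ℕ) p)
      = (((if c.k = d.k ∧ c.l = d.l then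
          ((U * V : ℕ) : ℝ) * ‖dft h c.k c.l‖ ^ 2 else 0 : ℝ)) : ℂ) := by
  have : ∀ p : Fin U × Fin V, (dft h c.k c.l * fourierExp (c.k : ℕ) (c.l : ℕ) p) *
        conj (dft h d.k d.l * fourierExp (d.k : ℕ) (d.l : ℕ) p)
      = dft h c.k c.l * conj (dft h d.k d.l) *
        fourierExp (((c.k : ℕ) : ℤ) + -(d.k : ℕ)) (((c.l : ℕ) : ℤ) + -(d.l : ℕ)) p := fun p => by
    rw [← fourierExp_mul, map_mul, conj_fourierExp]; ring
  simp only [this]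
  rw [← Finset.mul_sum, sum_fourierExp hU hV]
  simp only [natCast_dvd_sub_iff]
  split_ifs with hcd
  · rw [← hcd.1, ← hcd.2, Complex.mul_conj, Complex.normSq_eq_norm_sq]
    push_cast; ring
  · simp

/-- Polarization: products of real and imaginary parts reduce to the two character sums, without and
with conjugation. -/
lemma re_mul_re (a b : ℂ) : a.re * b.re = ((a * b).re + (a * conj b).re) / 2 := by
  simp

lemma im_mul_im (a b : ℂ) : a.im * b.im = ((a * conj b).re - (a * b).re) / 2 := by
  simp

lemma re_mul_im (a b : ℂ) : a.re * b.im = ((a * b).im - (a * conj b).im) / 2 := by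
  simp

/-- Both character sums are real, so this holds even when the two frequencies coincide. -/
lemma sum_weight_mul_weight_of_part_ne {U V : ℕ} (hU : 0 < U) (hV : 0 < V) (h : Image U V)
    {c d : CoeffIndex U V} (hc : c.part = Part.re) (hd : d.part = Part.im) :
    ∑ p, weight h c p * weight h d p = 0 := by
  simp only [weight, hc, hd, Part.proj, re_mul_im]
  rw [← Finset.sum_div, Finset.sum_sub_distrib, ← Complex.im_sum, ← Complex.im_sum,
    sum_mul_fourierExp hU hV, sum_mul_conj_fourierExp hU hV, Complex.ofReal_im, Complex.ofReal_im]
  simp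

open Classical in
lemma sum_weight_mul_weight_of_re {U V : ℕ} (hU : 0 < U) (hV : 0 < V) (h : Image U V)
    {c d : CoeffIndex U V} (hc : c.part = Part.re) (hd : d.part = Part.re) :
    ∑ p, weight h c p * weight h d p =
      ((if U ∣ (c.k : ℕ) + (d.k : ℕ) ∧ V ∣ (c.l : ℕ) + (d.l : ℕ) then
          ((U * V : ℕ) : ℝ) * ‖dft h c.k c.l‖ ^ 2 else 0) +
        (if c.k = d.k ∧ c.l = d.l then ((U * V : ℕ) : ℝ) * ‖dft h c.k c.l‖ ^ 2 else 0)) / 2 := by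
  simp only [weight, hc, hd, Part.proj, re_mul_re]
  rw [← Finset.sum_div, Finset.sum_add_distrib, ← Complex.re_sum, ← Complex.re_sum,
    sum_mul_fourierExp hU hV, sum_mul_conj_fourierExp hU hV, Complex.ofReal_re, Complex.ofReal_re]

open Classical in
lemma sum_weight_mul_weight_of_im {U V : ℕ} (hU : 0 < U) (hV : 0 < V) (h : Image U V)
    {c d : CoeffIndex U V} (hc : c.part = Part.im) (hd : d.part = Part.im) :
    ∑ p, weight h c p * weight h d p =
      ((if c.k = d.k ∧ c.l = d.l then ((U * V : ℕ) : ℝ) * ‖dft h c.k c.l‖ ^ 2 else 0) -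
        (if U ∣ (c.k : ℕ) + (d.k : ℕ) ∧ V ∣ (c.l : ℕ) + (d.l : ℕ) then
          ((U * V : ℕ) : ℝ) * ‖dft h c.k c.l‖ ^ 2 else 0)) / 2 := by
  simp only [weight, hc, hd, Part.proj, im_mul_im]
  rw [← Finset.sum_div, Finset.sum_sub_distrib, ← Complex.re_sum, ← Complex.re_sum,
    sum_mul_fourierExp hU hV, sum_mul_conj_fourierExp hU hV, Complex.ofReal_re, Complex.ofReal_re]

/-- The weight vectors of different coefficients are orthogonal. -/
lemma sum_weight_mul_weight_eq_zero {U V : ℕ} (hU : 0 < U) (hV : 0 < V) (h : Image U V)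
    {c d : CoeffIndex U V} (hcd : ¬ c.SameUpToConj d) :
    ∑ p, weight h c p * weight h d p = 0 := by
  simp only [CoeffIndex.SameUpToConj, not_and, not_or] at hcd
  rcases hc : c.part with _ | _ <;> rcases hd : d.part with _ | _
  · obtain ⟨h1, h2⟩ := hcd (hc.trans hd.symm)
    rw [sum_weight_mul_weight_of_re hU hV h hc hd, if_neg fun H => h2 H.1 H.2,
      if_neg fun H => h1 H.1 H.2]
    simp
  · exact sum_weight_mul_weight_of_part_ne hU hV h hc hd
  · simp only [mul_comm (weight h c _)]
    exact sum_weight_mul_weight_of_part_ne hU hV h hd hc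
  · obtain ⟨h1, h2⟩ := hcd (hc.trans hd.symm)
    rw [sum_weight_mul_weight_of_im hU hV h hc hd, if_neg fun H => h1 H.1 H.2,
      if_neg fun H => h2 H.1 H.2]
    simp

-- At a self-mirror frequency both character sums contribute: they add up for the real part and
-- cancel for the imaginary part. Elsewhere only the conjugated sum survives, whence `1 / 2`.
open Classical in
lemma sum_weight_sq {U V : ℕ} (hU : 0 < U) (hV : 0 < V) (h : Image U V) (c : CoeffIndex U V) :
    ∑ p, weight h c p ^ 2 = (U * V : ℕ) * ‖dft h c.k c.l‖ ^ 2 *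
      (if c.SelfConj then (if c.part = Part.im then 0 else 1) else 1 / 2) := by
  simp only [CoeffIndex.SelfConj, sq (weight h c _), two_mul]
  rcases hc : c.part with _ | _
  · rw [sum_weight_mul_weight_of_re hU hV h hc hc]
    simp only [and_self, if_true, reduceCtorEq, if_false]
    split_ifs <;> ring
  · rw [sum_weight_mul_weight_of_im hU hV h hc hc]
    simp only [and_self, if_true]
    split_ifs <;> ring

lemma sum_weight_sq_ne_zero_iff {U V : ℕ} (hU : 0 < U) (hV : 0 < V) (h : Image U V)
    (c : CoeffIndex U V) :
    ∑ p, weight h c p ^ 2 ≠ 0 ↔ dft h c.k c.l ≠ 0 ∧ ¬ (c.part = Part.im ∧ c.SelfConj) := by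
  rw [sum_weight_sq hU hV]
  by_cases h1 : c.SelfConj <;> by_cases h2 : c.part = Part.im <;>
    simp [h1, h2, hU.ne', hV.ne']

lemma abs_proj_le (s : Part) (z : ℂ) : |s.proj z| ≤ ‖z‖ := by
  cases s
  · exact Complex.abs_re_le_norm z
  · exact Complex.abs_im_le_norm z

/-- Each weight carries at most a fraction `2 / (U V)` of the total energy. -/
lemma weight_sq_le {U V : ℕ} (hU : 0 < U) (hV : 0 < V) (h : Image U V) (c : CoeffIndex U V)
    (p : Fin U × Fin V) :
    weight h c p ^ 2 ≤ 2 / (U * V : ℕ) * ∑ q, weight h c q ^ 2 := by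
  have hn : (0 : ℝ) < (U * V : ℕ) := by exact_mod_cast Nat.mul_pos hU hV
  -- Outside this case, where all weights vanish, the last factor in `sum_weight_sq` is at least `1
  -- / 2`; hence the constant `2`.
  by_cases hs : c.part = Part.im ∧ c.SelfConj
  · have h0 : ∑ q, weight h c q ^ 2 = 0 := by
      rw [sum_weight_sq hU hV]; simp [hs.1, hs.2]
    rw [h0, mul_zero]
    exact ((Finset.sum_eq_zero_iff_of_nonneg fun _ _ => sq_nonneg _).1 h0 p
      (Finset.mem_univ p)).le
  · have hw : weight h c p ^ 2 ≤ ‖dft h c.k c.l‖ ^ 2 := by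
      rw [sq_le_sq, abs_of_nonneg (norm_nonneg _)]
      refine (abs_proj_le _ _).trans ?_
      rw [norm_mul, norm_fourierExp, mul_one]
    rw [sum_weight_sq hU hV]
    refine hw.trans ?_
    have hz := sq_nonneg ‖dft h c.k c.l‖
    have : ∀ x y : ℝ, 2 / ((U * V : ℕ) : ℝ) * ((U * V : ℕ) * x * y) = 2 * (x * y) := fun x y => by
      field_simp
    rw [this]
    by_cases h1 : c.SelfConj
    · have h2 : c.part ≠ Part.im := fun h2 => hs ⟨h2, h1⟩
      simp only [h1, h2, if_true, if_false]; linarith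
    · simp only [h1, if_false]; linarith

end FourierNoise

/-! ### Moments of the coefficients and passage to the limit. -/

namespace FourierNoise

lemma memLp_of_hasLaw {ι Ω : Type*} [MeasurableSpace Ω] {P : Measure Ω} {ν : Measure ℝ}
    {η : ι → Ω → ℝ} (hν2 : MemLp id 2 ν) (hlaw : ∀ p, HasLaw (η p) ν P) (p : ι) :
    MemLp (η p) 2 P := by
  have h := (hlaw p).map_eq ▸ hν2
  exact (memLp_map_measure_iff (by fun_prop) (hlaw p).aemeasurable).1 h

section WeightedSum

variable {ι Ω : Type*} [Fintype ι] [MeasurableSpace Ω] {P : Measure Ω}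
  {ν : Measure ℝ} {η : ι → Ω → ℝ}

lemma memLp_weighted_sum (hν2 : MemLp id 2 ν) (hlaw : ∀ p, HasLaw (η p) ν P) (w : ι → ℝ) :
    MemLp (fun ω => ∑ p, w p * η p ω) 2 P :=
  memLp_finsetSum _ fun p _ => (memLp_of_hasLaw hν2 hlaw p).const_mul (w p)

lemma integral_weighted_sum [IsProbabilityMeasure P] (hν2 : MemLp id 2 ν)
    (hν0 : ∫ x, x ∂ν = 0) (hlaw : ∀ p, HasLaw (η p) ν P) (w : ι → ℝ) : ∫ ω, ∑ p, w p * η p ω ∂P = 0 := by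
  rw [integral_finsetSum]
  · refine Finset.sum_eq_zero fun p _ => ?_
    rw [integral_const_mul, (hlaw p).integral_eq, hν0, mul_zero]
  · exact fun p _ => ((memLp_of_hasLaw hν2 hlaw p).integrable (by simp)).const_mul (w p)

lemma variance_weighted_sum (hν2 : MemLp id 2 ν) (hlaw : ∀ p, HasLaw (η p) ν P)
    (hindep : iIndepFun η P) (w : ι → ℝ) :
    variance (fun ω => ∑ p, w p * η p ω) P = variance id ν * ∑ p, w p ^ 2 := by
  have heq : (fun ω => ∑ p, w p * η p ω) = ∑ p, fun ω => w p * η p ω := by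
    ext ω; simp
  rw [heq, IndepFun.variance_sum, Finset.mul_sum]
  · refine Finset.sum_congr rfl fun p _ => ?_
    rw [variance_const_mul, (hlaw p).variance_eq]
    exact mul_comm _ _
  · exact fun p _ => (memLp_of_hasLaw hν2 hlaw p).const_mul (w p)
  · intro p _ q _ hpq
    exact (hindep.indepFun hpq).comp (φ := fun x => w p * x) (ψ := fun x => w q * x)
      (by fun_prop) (by fun_prop)

end WeightedSum

section Coefficient

variable {Ω : Type*} [MeasurableSpace Ω] {P : Measure Ω} {ν : Measure ℝ} {U V : ℕ} {η : Fin U × Fin V → Ω → ℝ}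

lemma variance_noiseCoeff (hU : 0 < U) (hV : 0 < V) (hν2 : MemLp id 2 ν)
    (hlaw : ∀ p, HasLaw (η p) ν P) (hindep : iIndepFun η P) (h : Image U V)
    (c : CoeffIndex U V) :
    variance (noiseCoeff h η c) P = variance id ν * ∑ p, weight h c p ^ 2 := by
  rw [funext (noiseCoeff_eq_sum_weight hU hV h η c)]
  exact variance_weighted_sum hν2 hlaw hindep _

lemma integral_noiseCoeff [IsProbabilityMeasure P] (hU : 0 < U) (hV : 0 < V)
    (hν2 : MemLp id 2 ν)
    (hν0 : ∫ x, x ∂ν = 0) (hlaw : ∀ p, HasLaw (η p) ν P) (h : Image U V)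
    (c : CoeffIndex U V) : ∫ ω, noiseCoeff h η c ω ∂P = 0 := by
  simp only [noiseCoeff_eq_sum_weight hU hV h η c]
  exact integral_weighted_sum hν2 hν0 hlaw _

lemma variance_noiseCoeff_ne_zero_iff (hU : 0 < U) (hV : 0 < V) (hν2 : MemLp id 2 ν)
    (hlaw : ∀ p, HasLaw (η p) ν P) (hindep : iIndepFun η P) (h : Image U V)
    (c : CoeffIndex U V) :
    variance (noiseCoeff h η c) P ≠ 0 ↔
      variance id ν ≠ 0 ∧ dft h c.k c.l ≠ 0 ∧ ¬ (c.part = Part.im ∧ c.SelfConj) := by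
  rw [variance_noiseCoeff hU hV hν2 hlaw hindep, mul_ne_zero_iff,
    sum_weight_sq_ne_zero_iff hU hV]

lemma noiseCoeff_ae_eq_zero [IsProbabilityMeasure P] (hU : 0 < U) (hV : 0 < V)
    (hν2 : MemLp id 2 ν)
    (hν0 : ∫ x, x ∂ν = 0) (hlaw : ∀ p, HasLaw (η p) ν P) (h : Image U V)
    (c : CoeffIndex U V) (hvar : variance (noiseCoeff h η c) P = 0) :
    noiseCoeff h η c =ᵐ[P] 0 := by
  have hmem : MemLp (noiseCoeff h η c) 2 P := by
    rw [funext (noiseCoeff_eq_sum_weight hU hV h η c)]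
    exact memLp_weighted_sum hν2 hlaw _
  filter_upwards [ae_eq_integral_of_variance_eq_zero hmem hvar] with ω hω
  rw [hω, integral_noiseCoeff hU hV hν2 hν0 hlaw, Pi.zero_apply]

lemma standardize_noiseCoeff [IsProbabilityMeasure P] (hU : 0 < U) (hV : 0 < V)
    (hν2 : MemLp id 2 ν)
    (hν0 : ∫ x, x ∂ν = 0) (hlaw : ∀ p, HasLaw (η p) ν P) (h : Image U V)
    (c : CoeffIndex U V) (ω : Ω) :
    standardize P (noiseCoeff h η c) ω
      = ∑ p, weight h c p / √(variance (noiseCoeff h η c) P) * η p ω := by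
  rw [standardize, integral_noiseCoeff hU hV hν2 hν0 hlaw, sub_zero,
    noiseCoeff_eq_sum_weight hU hV, Finset.sum_div]
  exact Finset.sum_congr rfl fun p _ => by ring

/-- The bound does not involve `h`, `c` or `p`, so kernel and frequency may vary freely with the
image size. -/
lemma abs_weight_div_sqrt_variance_le (hU : 0 < U) (hV : 0 < V) (hν2 : MemLp id 2 ν)
    (hlaw : ∀ p, HasLaw (η p) ν P) (hindep : iIndepFun η P) (h : Image U V)
    (c : CoeffIndex U V) (p : Fin U × Fin V) :
    |weight h c p / √(variance (noiseCoeff h η c) P)|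
      ≤ √(2 / variance id ν / (U * V : ℕ)) := by
  have hvar := variance_noiseCoeff hU hV hν2 hlaw hindep h c
  apply Real.abs_le_sqrt
  rw [div_pow, Real.sq_sqrt (variance_nonneg _ _)]
  have hν := variance_nonneg id ν
  rcases (variance_nonneg (noiseCoeff h η c) P).eq_or_lt with h0 | hpos
  -- Division by zero gives normalized weight `0`; this also covers `variance id ν = 0`.
  · rw [← h0, div_zero]; positivity
  · rw [div_le_iff₀ hpos, hvar]
    have hne : variance id ν ≠ 0 := by
      rintro h0; rw [hvar, h0, zero_mul] at hpos; exact hpos.ne rfl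
    refine (weight_sq_le hU hV h c p).trans_eq ?_
    field_simp

lemma variance_mul_sum_weight_div (hU : 0 < U) (hV : 0 < V) (hν2 : MemLp id 2 ν)
    (hlaw : ∀ p, HasLaw (η p) ν P) (hindep : iIndepFun η P) (h : Image U V)
    (c : CoeffIndex U V) (hc : variance (noiseCoeff h η c) P ≠ 0) :
    variance id ν * ∑ p, weight h c p / √(variance (noiseCoeff h η c) P) *
      (weight h c p / √(variance (noiseCoeff h η c) P)) = 1 := by
  have hvar := variance_noiseCoeff hU hV hν2 hlaw hindep h c
  simp only [div_mul_div_comm, Real.mul_self_sqrt (variance_nonneg _ _), ← sq (weight h c _)]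
  rw [← Finset.sum_div, ← mul_div_assoc, ← hvar, div_self hc]

end Coefficient

theorem tendstoInDistribution_standardize_noiseCoeff
    (U V : ℕ → ℕ) (hU : ∀ N, 0 < U N) (hV : ∀ N, 0 < V N)
    (hUV : Tendsto (fun N => U N * V N) atTop atTop) (h : ∀ N, Image (U N) (V N))
    (ν : Measure ℝ) [IsProbabilityMeasure ν] (hν2 : MemLp id 2 ν) (hν0 : ∫ x, x ∂ν = 0)
    {Ω : ℕ → Type*} [∀ N, MeasurableSpace (Ω N)]
    (P : ∀ N, Measure (Ω N)) [∀ N, IsProbabilityMeasure (P N)]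
    (η : ∀ N, Fin (U N) × Fin (V N) → Ω N → ℝ)
    (hlaw : ∀ N p, HasLaw (η N p) ν (P N)) (hindep : ∀ N, iIndepFun (η N) (P N))
    {m : ℕ} (c : Fin m → ∀ N, CoeffIndex (U N) (V N)) (D : Finset (Fin m))
    (hdiff : ∀ᶠ N in atTop, ∀ i j, i ≠ j → ¬ (c i N).SameUpToConj (c j N))
    (hD : ∀ᶠ N in atTop, ∀ i,
      (i ∈ D ↔ variance (noiseCoeff (h N) (η N) (c i N)) (P N) ≠ 0)) :
    TendstoInDistribution
      (fun N ω i => standardize (P N) (noiseCoeff (h N) (η N) (c i N)) ω)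
      atTop (id : (Fin m → ℝ) → (Fin m → ℝ)) P
      (Measure.pi (fun i => gaussianReal 0 (if i ∈ D then (1 : ℝ≥0) else 0))) := by
  simp only [standardize_noiseCoeff (hU _) (hV _) hν2 hν0 (hlaw _)]
  refine tendstoInDistribution_weighted_sum ν hν2 hν0 P η hlaw hindep
    (fun N i p => weight (h N) (c i N) p / √(variance (noiseCoeff (h N) (η N) (c i N)) (P N)))
    D ?_ (ε := fun N => √(2 / variance id ν / (U N * V N : ℕ))) ?_ ?_
  · filter_upwards [hdiff, hD] with N hN hDN i j
    by_cases hij : i = j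
    · subst hij
      by_cases hi : i ∈ D
      · rw [if_pos ⟨rfl, hi⟩]
        exact variance_mul_sum_weight_div (hU N) (hV N) hν2 (hlaw N) (hindep N) _ _
          ((hDN i).1 hi)
      · have h0 : variance (noiseCoeff (h N) (η N) (c i N)) (P N) = 0 :=
          not_not.1 fun h0 => hi ((hDN i).2 h0)
        -- A degenerate coefficient has normalized weights `0` by division by zero, matching the
        -- zero diagonal entry outside `D`.
        simp [hi, h0]
    · rw [if_neg fun H => hij H.1]
      simp only [div_mul_div_comm]
      rw [← Finset.sum_div, sum_weight_mul_weight_eq_zero (hU N) (hV N) _ (hN i j hij),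
        zero_div, mul_zero]
  · have h1 : Tendsto (fun N => ((U N * V N : ℕ) : ℝ)) atTop atTop :=
      tendsto_natCast_atTop_atTop.comp hUV
    simpa using (h1.const_div_atTop (2 / variance id ν)).sqrt
  · exact Eventually.of_forall fun N i p =>
      abs_weight_div_sqrt_variance_le (hU N) (hV N) hν2 (hlaw N) (hindep N) _ _ p

end FourierNoise

theorem theorem2
    -- image sizes `U N × V N` with `U V → ∞`
    (U V : ℕ → ℕ) (hU : ∀ N, 0 < U N) (hV : ∀ N, 0 < V N)
    (hUV : Tendsto (fun N => U N * V N) atTop atTop)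
    -- the correlation kernels
    (h : ∀ N, FourierNoise.Image (U N) (V N))
    -- the common law of the i.i.d. noise: mean zero, finite variance
    (ν : Measure ℝ) [IsProbabilityMeasure ν] (hν2 : MemLp id 2 ν) (hν0 : ∫ x, x ∂ν = 0)
    -- the i.i.d. noise
    {Ω : ℕ → Type*} [∀ N, MeasurableSpace (Ω N)]
    (P : ∀ N, Measure (Ω N)) [∀ N, IsProbabilityMeasure (P N)]
    (η : ∀ N, Fin (U N) × Fin (V N) → Ω N → ℝ)
    (hlaw : ∀ N p, HasLaw (η N p) ν (P N))
    (hindep : ∀ N, iIndepFun (η N) (P N)) :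
    -- which coefficients are degenerate; those vanish almost surely
    (∀ N (c : FourierNoise.CoeffIndex (U N) (V N)),
      (variance (FourierNoise.noiseCoeff (h N) (η N) c) (P N) ≠ 0 ↔
        variance id ν ≠ 0 ∧ FourierNoise.dft (h N) c.k c.l ≠ 0 ∧
          ¬ (c.part = FourierNoise.Part.im ∧ c.SelfConj)) ∧
      (variance (FourierNoise.noiseCoeff (h N) (η N) c) (P N) = 0 →
        FourierNoise.noiseCoeff (h N) (η N) c =ᵐ[P N] 0)) ∧
    -- (i) each coefficient is asymptotically Gaussian
    (∀ c : ∀ N, FourierNoise.CoeffIndex (U N) (V N),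
      (∀ᶠ N in atTop, variance (FourierNoise.noiseCoeff (h N) (η N) (c N)) (P N) ≠ 0) →
      TendstoInDistribution
        (fun N => FourierNoise.standardize (P N) (FourierNoise.noiseCoeff (h N) (η N) (c N)))
        atTop (id : ℝ → ℝ) P (gaussianReal 0 1)) ∧
    -- (ii) finitely many different coefficients are asymptotically independent:
    -- their joint law converges to a product of (possibly degenerate) Gaussian laws
    (∀ (m : ℕ) (c : Fin m → ∀ N, FourierNoise.CoeffIndex (U N) (V N)) (D : Finset (Fin m)),
      (∀ᶠ N in atTop, ∀ i j, i ≠ j → ¬ (c i N).SameUpToConj (c j N)) →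
      (∀ᶠ N in atTop, ∀ i,
        (i ∈ D ↔ variance (FourierNoise.noiseCoeff (h N) (η N) (c i N)) (P N) ≠ 0)) →
      TendstoInDistribution
        (fun N ω i =>
          FourierNoise.standardize (P N) (FourierNoise.noiseCoeff (h N) (η N) (c i N)) ω)
        atTop (id : (Fin m → ℝ) → (Fin m → ℝ)) P
        (Measure.pi (fun i => gaussianReal 0 (if i ∈ D then (1 : ℝ≥0) else 0)))) := by
  refine ⟨fun N c => ⟨?_, ?_⟩, fun c hc => ?_, fun m c D hdiff hD => ?_⟩
  · exact FourierNoise.variance_noiseCoeff_ne_zero_iff (hU N) (hV N) hν2 (hlaw N) (hindep N) _ c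
  · exact FourierNoise.noiseCoeff_ae_eq_zero (hU N) (hV N) hν2 hν0 (hlaw N) _ c
  -- Part (i) is the vector statement for one coordinate, pushed forward by evaluation at `0`.
  · have hvec := FourierNoise.tendstoInDistribution_standardize_noiseCoeff U V hU hV hUV h ν hν2
      hν0 P η hlaw hindep (fun _ : Fin 1 => c) Finset.univ
      (Eventually.of_forall fun N i j hij => absurd (Subsingleton.elim i j) hij)
      (hc.mono fun N hN i => iff_of_true (Finset.mem_univ i) hN)
    have hcomp := hvec.continuous_comp (continuous_apply (0 : Fin 1))
    refine ⟨hcomp.forall_aemeasurable, aemeasurable_id, ?_⟩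
    have hlim : (Measure.pi fun i : Fin 1 =>
          gaussianReal 0 (if i ∈ (Finset.univ : Finset (Fin 1)) then (1 : ℝ≥0) else 0)).map
          ((fun x : Fin 1 → ℝ => x 0) ∘ id)
        = (gaussianReal 0 1).map id := by
      rw [Measure.map_id]
      simpa using (measurePreserving_eval (fun i : Fin 1 =>
        gaussianReal 0 (if i ∈ (Finset.univ : Finset (Fin 1)) then (1 : ℝ≥0) else 0)) 0).map_eq
    have htendsto := hcomp.tendsto
    simp only [hlim] at htendsto
    exact htendsto
  · exact FourierNoise.tendstoInDistribution_standardize_noiseCoeff U V hU hV hUV h ν hν2 hν0 P η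
      hlaw hindep c D hdiff hD
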